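/- **Definitions.** Let $L,F\ge 1$ be integers; tasks are labelled by $\{0,\dots,F-1\}$. An $(N,L,F)$-*task allocation scheme* (TAS) is a list $S=(S_1,\dots,S_N)$ of sets of tasks such that every task lies in exactly $L$ of the sets and $|S_n|=LF/N$ for all $n$ (in particular $LF/N\in\mathbb Z$). When one machine leaves an $(N,L,F)$-TAS $S$ (then $N'=N-1$) or one machine joins it (then $N'=N+1$) and an $(N',L,F)$-TAS $S'$ is used next, the *transition waste* is $$\sum_n\Bigl(|S_n\,\triangle\,S'_n|-\bigl|\tfrac{LF}{N}-\tfrac{LF}{N'}\bigr|\Bigr),$$ where $n$ runs over the machines that are present both before and after. An $(N_0,L,F)$-*elastic task allocation scheme* is a pair $(S^{N_0},\mathcal T)$ of an $(N_0,L,F)$-TAS $S^{N_0}$ and a map $\mathcal T$ which sends a TAS $S$, together with an event (a given machine leaves, or a machine joins), to a TAS for the new number of machines, whenever such a TAS exists. For $L\le N_{\min}\le N_{\max}\le F$, the range $[N_{\min},N_{\max}]$ is an $(L,F)$-*zero-waste range* if for every $N_0\in[N_{\min},N_{\max}]$ there is an $(N_0,L,F)$-elastic task allocation scheme $(S^{N_0},\mathcal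 T)$ such that, when the system starts in $S^{N_0}$ and machines leave and join one at a time, in any order and any number of times, every transition between two numbers of machines in $[N_{\min},N_{\max}]$ has transition waste $0$. **Corollary.** In each of the following cases, $[N_{\min},N_{\max}]$ is an $(L,F)$-zero-waste range for every relevant $F$, that is, for every $F\ge1$ that is divisible by $N(N-1)$ for all $N\in[N_{\min}+1,N_{\max}]$. 1. $L=3$, $N_{\max}\ge 7$, $N_{\min}=N_{\max}-\left\lfloor\frac{7N_{\max}-5-\sqrt{\Delta}}{10}\right\rfloor-1$, where $\Delta=9N_{\max}^2+90N_{\max}+25$. 2. $L=4$, $N_{\max}\ge 13$, $N_{\min}=N_{\max}-\left\lfloor\frac{10N_{\max}-7-\sqrt{\Delta}}{14}\right\rfloor-1$, where $\Delta=16N_{\max}^2+280N_{\max}+49$. 3. $L=q+1$, $N_{\max}=q^2+q+1$, $N_{\min}=N_{\max}-\left\lfloor\frac{3q^3+4q^2+2q-\sqrt{\Delta}}{4q+2}\right\rfloor-1$, where $\Delta=q^6+12q^5+24q^4+24q^3+16q^2+4q$, for every prime power $q$. 4. $L=q$, $N_{\max}=q^2$, $N_{\min}=N_{\max}-\left\lfloor\frac{3q^3-2q^2-2q+1-\sqrt{\Delta}}{4q-2}\right\rfloor-1$,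 where $\Delta=q^6+8q^5-16q^4+6q^3+4q^2-4q+1$, for every prime power $q$. 5. $L=q$, $N_{\max}=q^2-1$, $N_{\min}=N_{\max}-\left\lfloor\frac{3q^3-2q^2-5q+3-\sqrt{\Delta}}{4q-2}\right\rfloor-1$, where $\Delta=q^6+8q^5-18q^4-2q^3+21q^2-10q+1$, for every prime power $q$. -/

import Mathlib

/-- An ordered list of `N` sets of tasks, one for each machine; the tasks are labelled by
`{0, …, F - 1}`. -/
abbrev TaskList (N F : ℕ) : Type := Fin N → Finset (Fin F)

/-- `S` is an `(N, L, F)` task allocation scheme: every task belongs to exactly `L` of the sets,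
and all sets have the size `L F / N`, which is assumed to be an integer. -/
structure IsTAS {N F : ℕ} (L : ℕ) (S : TaskList N F) : Prop where
  redundancy : ∀ f : Fin F, (Finset.univ.filter fun n : Fin N => f ∈ S n).card = L
  integral : N ∣ L * F
  load : ∀ n : Fin N, (S n).card = L * F / N

/-- There is an `(N, L, F)` task allocation scheme. -/
def ExistsTAS (N L F : ℕ) : Prop := ∃ S : TaskList N F, IsTAS L S

/-- The necessary load change `|L F / N - L F / N'|`. -/
def necessaryLoadChange (L F N N' : ℕ) : ℚ :=
  |((L : ℚ) * F) / N - ((L : ℚ) * F) / N'|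

/-- The transition waste at one machine whose set of tasks changes from `A` to `B` while the
number of machines changes from `N` to `N'`. -/
def machineWaste {F : ℕ} (L N N' : ℕ) (A B : Finset (Fin F)) : ℚ :=
  ((symmDiff A B).card : ℚ) - necessaryLoadChange L F N N'

/-- The transition waste when machine `n` leaves. The remaining machines keep their order, so the
machine with the new index `i` is the one with the old index `n.succAbove i`. -/
def leaveWaste {N F : ℕ} (L : ℕ) (S : TaskList (N + 1) F) (n : Fin (N + 1))
    (S' : TaskList N F) : ℚ :=
  ∑ i : Fin N, machineWaste L (N + 1) N (S (n.succAbove i)) (S' i)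

/-- The transition waste when a machine joins. The new machine gets the last index, and the sum
is over the machines that were present before. -/
def joinWaste {N F : ℕ} (L : ℕ) (S : TaskList N F) (S' : TaskList (N + 1) F) : ℚ :=
  ∑ i : Fin N, machineWaste L N (N + 1) (S i) (S' i.castSucc)

/-- A transition map: from the current list of task sets alone it computes the next list, when a
given machine leaves and when a machine joins. -/
structure TransitionMap (F : ℕ) where
  leave : (N : ℕ) → TaskList (N + 1) F → Fin (N + 1) → TaskList N F
  join : (N : ℕ) → TaskList N F → TaskList (N + 1) F

/-- `(S₀, T)` is an `(N₀, L, F)` elastic task allocation scheme: `S₀` is an `(N₀, L, F)` task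
allocation scheme, and `T` sends task allocation schemes to task allocation schemes whenever one
exists for the new number of machines (there is none, for example, for fewer than `L` machines). -/
structure IsETAS {N₀ F : ℕ} (L : ℕ) (S₀ : TaskList N₀ F) (T : TransitionMap F) : Prop where
  start : IsTAS L S₀
  leave : ∀ (N : ℕ) (S : TaskList (N + 1) F) (n : Fin (N + 1)),
    IsTAS L S → ExistsTAS N L F → IsTAS L (T.leave N S n)
  join : ∀ (N : ℕ) (S : TaskList N F),
    IsTAS L S → ExistsTAS (N + 1) L F → IsTAS L (T.join N S)

/-- The lists of task sets that occur when the system starts with `S₀`, machines leave and join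
one at a time in any order, and `T` reallocates the tasks. -/
inductive Reachable {N₀ F : ℕ} (L : ℕ) (S₀ : TaskList N₀ F) (T : TransitionMap F) :
    (N : ℕ) → TaskList N F → Prop
  | start : Reachable L S₀ T N₀ S₀
  | leave {N : ℕ} {S : TaskList (N + 1) F} (n : Fin (N + 1)) :
      Reachable L S₀ T (N + 1) S → ExistsTAS N L F → Reachable L S₀ T N (T.leave N S n)
  | join {N : ℕ} {S : TaskList N F} :
      Reachable L S₀ T N S → ExistsTAS (N + 1) L F → Reachable L S₀ T (N + 1) (T.join N S)

/-- Every transition that occurs, starting from `S₀`, between two numbers of machines in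
`[Nmin, Nmax]` has transition waste zero. -/
structure ZeroWasteWithin {N₀ F : ℕ} (L : ℕ) (S₀ : TaskList N₀ F) (T : TransitionMap F)
    (Nmin Nmax : ℤ) : Prop where
  leave : ∀ (N : ℕ) (S : TaskList (N + 1) F) (n : Fin (N + 1)),
    Reachable L S₀ T (N + 1) S → Nmin ≤ (N : ℤ) → ((N + 1 : ℕ) : ℤ) ≤ Nmax →
      leaveWaste L S n (T.leave N S n) = 0
  join : ∀ (N : ℕ) (S : TaskList N F),
    Reachable L S₀ T N S → Nmin ≤ (N : ℤ) → ((N + 1 : ℕ) : ℤ) ≤ Nmax →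
      joinWaste L S (T.join N S) = 0

/-- `[Nmin, Nmax]` is an `(L, F)`-zero-waste range. -/
structure IsZeroWasteRange (L F : ℕ) (Nmin Nmax : ℤ) : Prop where
  le_min : (L : ℤ) ≤ Nmin
  min_le_max : Nmin ≤ Nmax
  max_le : Nmax ≤ (F : ℤ)
  exists_scheme : ∀ N₀ : ℕ, Nmin ≤ (N₀ : ℤ) → (N₀ : ℤ) ≤ Nmax →
    ∃ (S₀ : TaskList N₀ F) (T : TransitionMap F),
      IsETAS L S₀ T ∧ ZeroWasteWithin L S₀ T Nmin Nmax

/-- `[Nmin, Nmax]` is an `(L, F)`-zero-waste range for all relevant `F`: all positive `F` that are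
divisible by `N (N - 1)` for every `N` in `[Nmin + 1, Nmax]`. -/
def ZeroWasteForRelevant (L : ℕ) (Nmin Nmax : ℤ) : Prop :=
  ∀ F : ℕ, 0 < F → (∀ N : ℤ, Nmin + 1 ≤ N → N ≤ Nmax → N * (N - 1) ∣ (F : ℤ)) →
    IsZeroWasteRange L F Nmin Nmax

/-! Take the machines as the points of a configuration with M = Nmax points and M lines, and replace
each line by k = F/M tasks. Two points share at most one line, so two machines share at most k
tasks.

A transition has no waste if all surviving sets grow (leave) or shrink (join). For a leave, the
departing machine's tasks must be spread evenly over the others, none going to a machine that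
already holds it. By Hall's theorem this works once the departing set meets each other set in few
tasks (`exists_leave_last`). Allocations reached from the base by such leaves keep the base sets
inside the current ones, so intersections exceed k by at most twice the growth of a load
(`card_inter_le`). Comparing this with Hall's bound gives a quadratic inequality in the number of
machines, and its larger root is the stated lower end. A join reverts to an earlier allocation in
such a chain of leaves (`exists_join`). -/

/-! ### Balanced assignment by Hall's theorem -/

/-- A capacitated form of Hall's theorem: if no machine holds more than `c * r` of the tasks in `A`,
and every task in `A` is missing at `r` machines at least, then the tasks of `A` can be given to
machines that do not hold them, `c` to each. -/
theorem exists_balanced_assignment {α β : Type*} [Fintype β] [DecidableEq α] [DecidableEq β]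
    (A : Finset α) (R : β → Finset α) (c r : ℕ) (hA : A.card = Fintype.card β * c)
    (hr : ∀ a ∈ A, r ≤ (Finset.univ.filter fun b => a ∉ R b).card)
    (hR : ∀ b, (A ∩ R b).card ≤ r * c) :
    ∃ g : A → β, (∀ a, (a : α) ∉ R (g a)) ∧
      ∀ b, (Finset.univ.filter fun a => g a = b).card = c := by
  classical
  obtain ⟨f, hf, hft⟩ := (Finset.all_card_le_biUnion_card_iff_exists_injective
    (fun a : A => (Finset.univ.filter fun b => (a : α) ∉ R b) ×ˢ (Finset.univ : Finset (Fin c)))).1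
    (by
      intro s
      rcases s.eq_empty_or_nonempty with rfl | ⟨a₀, ha₀⟩
      · simp
      set J : Finset β := s.biUnion fun a => Finset.univ.filter fun b => (a : α) ∉ R b with hJ
      have hprod : (s.biUnion fun a : A => (Finset.univ.filter fun b => (a : α) ∉ R b) ×ˢ
          (Finset.univ : Finset (Fin c))) = J ×ˢ (Finset.univ : Finset (Fin c)) := by
        ext ⟨b, i⟩
        simp [hJ]
      rw [hprod, Finset.card_product, Finset.card_univ, Fintype.card_fin]
      -- Each machine counts as `c` slots. If some machine is admissible for no task of `s`, it
      -- holds all of `s`, so `s` has at most `r * c` tasks, while a single task already has `r * c`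
      -- slots.
      by_cases hJu : J = Finset.univ
      · rw [hJu, Finset.card_univ, ← hA]
        exact (Finset.card_le_univ s).trans (by simp)
      · obtain ⟨b, hb⟩ : ∃ b, b ∉ J := by
          by_contra! h
          exact hJu (Finset.eq_univ_iff_forall.2 h)
        have hsub : s.map ⟨Subtype.val, Subtype.val_injective⟩ ⊆ A ∩ R b := by
          intro x hx
          obtain ⟨a, ha, rfl⟩ := Finset.mem_map.1 hx
          refine Finset.mem_inter.2 ⟨a.2, ?_⟩
          by_contra h
          exact hb (Finset.mem_biUnion.2 ⟨a, ha, by simpa using h⟩)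
        have h1 := (Finset.card_le_card hsub).trans (hR b)
        rw [Finset.card_map] at h1
        refine h1.trans (Nat.mul_le_mul_right c ((hr a₀ a₀.2).trans (Finset.card_le_card ?_)))
        exact Finset.subset_biUnion_of_mem
          (fun a : A => Finset.univ.filter fun b => (a : α) ∉ R b) ha₀)
  -- Tasks and slots are equal in number, so the matching fills every slot.
  have hbij : Function.Bijective f :=
    (Fintype.bijective_iff_injective_and_card f).2 ⟨hf, by simp [hA]⟩
  refine ⟨fun a => (f a).1, fun a => by simpa using hft a, fun b => ?_⟩
  have : (Finset.univ.filter fun a => (f a).1 = b).card =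
      ((Finset.univ : Finset (Fin c)).map ⟨fun i => (b, i), fun i j h => by simpa using h⟩).card := by
    refine Finset.card_bij (fun a _ => f a) ?_ (fun a _ a' _ h => hf h) ?_
    · intro a ha
      simp only [Finset.mem_filter, Finset.mem_univ, true_and] at ha
      simp only [Finset.mem_map, Finset.mem_univ, true_and]
      exact ⟨(f a).2, by subst ha; rfl⟩
    · intro p hp
      obtain ⟨i, -, rfl⟩ := Finset.mem_map.1 hp
      obtain ⟨a, ha⟩ := hbij.2 (b, i)
      exact ⟨a, by simp [ha], ha⟩
  rw [this, Finset.card_map, Finset.card_univ, Fintype.card_fin]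

/-! ### Transitions without waste -/

theorem IsTAS.load_cast {N L F : ℕ} {S : TaskList N F} (h : IsTAS L S) (n : Fin N) :
    ((S n).card : ℚ) = (L : ℚ) * F / N := by
  have hN : (N : ℚ) ≠ 0 := by
    have := n.pos
    positivity
  rw [h.load n, Nat.cast_div h.integral hN, Nat.cast_mul]

theorem IsTAS.comp_perm {N L F : ℕ} {S : TaskList N F} (h : IsTAS L S)
    (σ : Equiv.Perm (Fin N)) : IsTAS L (S ∘ σ) := by
  refine ⟨fun f => ?_, h.integral, fun n => h.load (σ n)⟩
  rw [← h.redundancy f]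
  exact Finset.card_bij (fun n _ => σ n) (fun n hn => by simpa using hn)
    (fun a _ b _ hab => σ.injective hab) fun n hn => ⟨σ.symm n, by simpa using hn, by simp⟩

theorem machineWaste_symm {F : ℕ} (L N N' : ℕ) (A B : Finset (Fin F)) :
    machineWaste L N N' A B = machineWaste L N' N B A := by
  simp [machineWaste, necessaryLoadChange, symmDiff_comm A B, abs_sub_comm]

/-- For nested sets the symmetric difference has exactly the size of the load change. -/
theorem machineWaste_eq_zero {F L N N' : ℕ} {A B : Finset (Fin F)} (h : A ⊆ B)
    (hA : (A.card : ℚ) = (L : ℚ) * F / N) (hB : (B.card : ℚ) = (L : ℚ) * F / N') :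
    machineWaste L N N' A B = 0 := by
  have h1 : symmDiff A B = B \ A := by
    rw [symmDiff_def, Finset.sup_eq_union, Finset.sdiff_eq_empty_iff_subset.2 h,
      Finset.empty_union]
  have h2 : (A.card : ℚ) ≤ B.card := by exact_mod_cast Finset.card_le_card h
  rw [machineWaste, necessaryLoadChange, ← hA, ← hB, h1, Finset.card_sdiff_of_subset h,
    Nat.cast_sub (Finset.card_le_card h), abs_sub_comm, abs_of_nonneg (by linarith), sub_self]

theorem leaveWaste_eq_zero {N F L : ℕ} {S : TaskList (N + 1) F} {n : Fin (N + 1)}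
    {S' : TaskList N F} (hS : IsTAS L S) (hS' : IsTAS L S')
    (h : ∀ i, S (n.succAbove i) ⊆ S' i) : leaveWaste L S n S' = 0 :=
  Finset.sum_eq_zero fun i _ =>
    machineWaste_eq_zero (h i) (hS.load_cast _) (hS'.load_cast i)

theorem joinWaste_eq_zero {N F L : ℕ} {S : TaskList N F} {S' : TaskList (N + 1) F}
    (hS : IsTAS L S) (hS' : IsTAS L S') (h : ∀ i, S' (Fin.castSucc i) ⊆ S i) :
    joinWaste L S S' = 0 :=
  Finset.sum_eq_zero fun i _ => by
    rw [machineWaste_symm]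
    exact machineWaste_eq_zero (h i) (hS'.load_cast _) (hS.load_cast i)

/-- If the pairwise intersections with the last set are small, then the tasks of the last machine
can be distributed evenly to the others. -/
theorem IsTAS.exists_leave_last {N F L : ℕ} {S : TaskList (N + 1) F} (hS : IsTAS L S)
    (c : ℕ) (hLN : L ≤ N) (hc : L * F = (N + 1) * N * c)
    (hint : ∀ i : Fin N, (S (Fin.last N) ∩ S i.castSucc).card ≤ (N + 1 - L) * c) :
    ∃ S' : TaskList N F, IsTAS L S' ∧ ∀ i : Fin N, S i.castSucc ⊆ S' i := by
  classical
  have hload : ∀ n, (S n).card = N * c := fun n => by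
    rw [hS.load, hc, mul_assoc, Nat.mul_div_cancel_left _ N.succ_pos]
  have hred : ∀ f, (Finset.univ.filter fun i : Fin N => f ∈ S i.castSucc).card +
      (if f ∈ S (Fin.last N) then 1 else 0) = L := fun f => by
    have h := hS.redundancy f
    rw [Finset.card_filter, Fin.sum_univ_castSucc] at h
    rw [Finset.card_filter, h]
  -- A task of the last machine lies at `L - 1` of the other `N`, hence is missing at `N + 1 - L`.
  obtain ⟨g, hg, hgc⟩ := exists_balanced_assignment (S (Fin.last N)) (fun i : Fin N => S i.castSucc)
    c (N + 1 - L) (by rw [hload, Fintype.card_fin]) (fun a ha => by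
      have h1 := hred a
      have h2 := Finset.card_filter_add_card_filter_not (s := (Finset.univ : Finset (Fin N)))
        (fun i => a ∈ S i.castSucc)
      rw [if_pos ha] at h1
      rw [Finset.card_univ, Fintype.card_fin] at h2
      omega) hint
  let E : Fin N → Finset (Fin F) := fun i =>
    (Finset.univ.filter fun a => g a = i).map ⟨Subtype.val, Subtype.val_injective⟩
  have hE : ∀ i f, f ∈ E i ↔ ∃ h : f ∈ S (Fin.last N), g ⟨f, h⟩ = i := fun i f => by
    simp [E]
  have hdisj : ∀ i, Disjoint (S i.castSucc) (E i) := fun i => by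
    refine Finset.disjoint_left.2 fun f hf hfE => ?_
    obtain ⟨h, rfl⟩ := (hE i f).1 hfE
    exact hg _ hf
  refine ⟨fun i => S i.castSucc ∪ E i, ⟨fun f => ?_, ⟨(N + 1) * c, by rw [hc]; ring⟩, fun i => ?_⟩,
    fun i => Finset.subset_union_left⟩
  · rw [← hred f]
    have h1 : (Finset.univ.filter fun i : Fin N => f ∈ S i.castSucc ∪ E i) =
        (Finset.univ.filter fun i : Fin N => f ∈ S i.castSucc) ∪
          Finset.univ.filter fun i : Fin N => f ∈ E i := by
      ext i
      simp
    rw [h1, Finset.card_union_of_disjoint]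
    · congr 1
      split_ifs with h
      · rw [Finset.card_eq_one]
        refine ⟨g ⟨f, h⟩, ?_⟩
        ext i
        simp [hE, h, eq_comm]
      · simp [hE, h]
    · refine Finset.disjoint_left.2 fun i hi hi' => ?_
      exact Finset.disjoint_left.1 (hdisj i) (by simpa using hi) (by simpa using hi')
  · have hN : 0 < N := i.pos
    rw [Finset.card_union_of_disjoint (hdisj i), hload, Finset.card_map, hgc, hc,
      show (N + 1) * N * c = N * (N * c + c) by ring, Nat.mul_div_cancel_left _ hN]

/-! ### Descendants of a base allocation -/

/-- The schemes obtained from `B` by letting machines leave one at a time, without transition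
waste, and by renumbering the machines. -/
inductive Descendant {M F : ℕ} (L : ℕ) (B : TaskList M F) : (N : ℕ) → TaskList N F → Prop
  | base : Descendant L B M B
  | perm {N : ℕ} {S : TaskList N F} (σ : Equiv.Perm (Fin N)) :
      Descendant L B N S → Descendant L B N (S ∘ σ)
  | leave {N : ℕ} {S : TaskList (N + 1) F} {S' : TaskList N F} :
      Descendant L B (N + 1) S → IsTAS L S' → (∀ i : Fin N, S i.castSucc ⊆ S' i) →
        Descendant L B N S'

namespace Descendant

variable {M F L : ℕ} {B : TaskList M F}

theorem isTAS (hB : IsTAS L B) {N : ℕ} {S : TaskList N F} (h : Descendant L B N S) :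
    IsTAS L S := by
  induction h with
  | base => exact hB
  | perm σ _ ih => exact ih.comp_perm σ
  | leave _ h _ _ => exact h

theorem exists_embedding {N : ℕ} {S : TaskList N F} (h : Descendant L B N S) :
    ∃ φ : Fin N → Fin M, Function.Injective φ ∧ ∀ i, B (φ i) ⊆ S i := by
  induction h with
  | base => exact ⟨id, Function.injective_id, fun i => subset_rfl⟩
  | perm σ _ ih =>
    obtain ⟨φ, h1, h2⟩ := ih
    exact ⟨φ ∘ σ, h1.comp σ.injective, fun i => h2 (σ i)⟩
  | leave _ _ h ih =>
    obtain ⟨φ, h1, h2⟩ := ih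
    exact ⟨φ ∘ Fin.castSucc, h1.comp (Fin.castSucc_injective _), fun i => (h2 _).trans (h i)⟩

/-- A joining machine can undo the last leave. -/
theorem exists_join {N : ℕ} {S : TaskList N F} (h : Descendant L B N S) (hN : N < M) :
    ∃ S' : TaskList (N + 1) F, Descendant L B (N + 1) S' ∧ ∀ i : Fin N, S' i.castSucc ⊆ S i := by
  induction h with
  | base => exact absurd hN (lt_irrefl _)
  | leave h _ hsub _ => exact ⟨_, h, hsub⟩
  | @perm N S σ _ ih =>
    obtain ⟨S', h1, h2⟩ := ih hN
    -- The renumbering is extended by fixing the new last machine.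
    refine ⟨_, h1.perm ((finSuccEquivLast.trans σ.optionCongr).trans finSuccEquivLast.symm),
      fun i => ?_⟩
    simpa using h2 (σ i)

/-- The sets of two machines of a descendant of `B` have not many more tasks in common than the
corresponding sets of `B`. -/
theorem card_inter_le (hB : IsTAS L B) {k : ℕ}
    (hk : ∀ i j, i ≠ j → (B i ∩ B j).card ≤ k) {N : ℕ} {S : TaskList N F}
    (h : Descendant L B N S) {i j : Fin N} (hij : i ≠ j) :
    ((S i ∩ S j).card : ℚ) ≤ k + 2 * ((L : ℚ) * F / N - (L : ℚ) * F / M) := by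
  have hS := h.isTAS hB
  obtain ⟨φ, hφ, hsub⟩ := h.exists_embedding
  have hcard : ∀ i, ((S i \ B (φ i)).card : ℚ) = (L : ℚ) * F / N - (L : ℚ) * F / M := fun i => by
    rw [Finset.card_sdiff_of_subset (hsub i), Nat.cast_sub (Finset.card_le_card (hsub i)),
      hS.load_cast, hB.load_cast]
  have hcover : S i ∩ S j ⊆ (B (φ i) ∩ B (φ j)) ∪ (S i \ B (φ i) ∪ S j \ B (φ j)) := by
    intro x
    simp only [Finset.mem_inter, Finset.mem_union, Finset.mem_sdiff]
    tauto
  have h1 := (Finset.card_le_card hcover).trans ((Finset.card_union_le _ _).trans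
    (Nat.add_le_add (hk _ _ (hφ.ne hij)) (Finset.card_union_le _ _)))
  have h2 : ((S i ∩ S j).card : ℚ) ≤ k + ((S i \ B (φ i)).card + (S j \ B (φ j)).card) := by
    exact_mod_cast h1
  rw [hcard, hcard] at h2
  linarith

/-- `hineq` is Hall's bound for the departing machine, with the estimate of `card_inter_le` inserted
and the common factor `d / M` removed. -/
theorem exists_leave (hB : IsTAS L B) {k : ℕ} (hF : F = M * k)
    (hk : ∀ i j, i ≠ j → (B i ∩ B j).card ≤ k) {N : ℕ} {S : TaskList (N + 1) F}
    (h : Descendant L B (N + 1) S) (n : Fin (N + 1)) (hN : 0 < N) (hM : 0 < M)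
    (hdvd : (N + 1) * N ∣ F)
    (hineq : ((N : ℤ) + 1) * N + 2 * L * (M - (N + 1)) * N ≤ L * M * (N + 1 - L)) (hLN : L ≤ N) :
    ∃ S' : TaskList N F, Descendant L B N S' ∧ ∀ i : Fin N, S (n.succAbove i) ⊆ S' i := by
  obtain ⟨d, hd⟩ := hdvd
  -- Moves machine `n` to the last place and keeps the order of the others.
  let σ : Equiv.Perm (Fin (N + 1)) := finSuccEquivLast.trans (finSuccEquiv' n).symm
  have hσ := h.perm σ
  have hσc : ∀ i : Fin N, (S ∘ σ) i.castSucc = S (n.succAbove i) := fun i => by simp [σ]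
  obtain ⟨S', h1, h2⟩ := (hσ.isTAS hB).exists_leave_last (L * d) hLN (by rw [hd]; ring)
    (fun i => by
      have h3 := hσ.card_inter_le hB hk (Fin.castSucc_lt_last i).ne'
      have hNq : (0 : ℚ) < N := by exact_mod_cast hN
      have hMq : (0 : ℚ) < M := by exact_mod_cast hM
      have hq : ((N : ℚ) + 1) * N + 2 * L * (M - (N + 1)) * N ≤ L * M * (N + 1 - L) := by
        exact_mod_cast hineq
      have hdq : (0 : ℚ) ≤ d := by positivity
      have hFq : (F : ℚ) = (N + 1) * N * d := by exact_mod_cast hd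
      have hkq : (k : ℚ) = (N + 1) * N * d / M := by
        rw [← hFq, hF]
        push_cast
        field_simp
      have h4 : ((((S ∘ σ) (Fin.last N) ∩ (S ∘ σ) i.castSucc).card : ℕ) : ℚ) ≤
          (((N + 1 - L) * (L * d) : ℕ) : ℚ) := by
        refine h3.trans ?_
        rw [Nat.cast_mul, Nat.cast_sub (by omega), hkq, hFq]
        push_cast
        have h5 : ((N : ℚ) + 1) * N * d / M + 2 * ((L : ℚ) * ((N + 1) * N * d) / (N + 1) -
            L * ((N + 1) * N * d) / M) =
            (((N : ℚ) + 1) * N + 2 * L * (M - (N + 1)) * N) * (d / M) := by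
          field_simp
        have h6 : ((N : ℚ) + 1 - L) * (L * d) = (L * M * (N + 1 - L)) * (d / M) := by
          field_simp
        rw [h5, h6]
        exact mul_le_mul_of_nonneg_right hq (by positivity)
      exact_mod_cast h4)
  exact ⟨S', hσ.leave h1 h2, fun i => by rw [← hσc]; exact h2 i⟩

end Descendant

/-! ### A transition map without memory -/

/-- The transition map sees only the current list, so it must make one choice serving three nested
aims: a waste-free descendant, else any descendant, else any valid scheme. The middle aim restores
descendants after an excursion outside the range. -/
theorem exists_preferred {α : Type*} [Nonempty α] {p q r : α → Prop} (hpq : ∀ x, p x → q x)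
    (hqr : ∀ x, q x → r x) :
    ∃ x, ((∃ y, p y) → p x) ∧ ((∃ y, q y) → q x) ∧ ((∃ y, r y) → r x) := by
  by_cases hp : ∃ y, p y
  · obtain ⟨y, hy⟩ := hp
    exact ⟨y, fun _ => hy, fun _ => hpq y hy, fun _ => hqr y (hpq y hy)⟩
  by_cases hq : ∃ y, q y
  · obtain ⟨y, hy⟩ := hq
    exact ⟨y, fun h => absurd h hp, fun _ => hy, fun _ => hqr y hy⟩
  by_cases hr : ∃ y, r y
  · obtain ⟨y, hy⟩ := hr
    exact ⟨y, fun h => absurd h hp, fun h => absurd h hq, fun _ => hy⟩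
  · exact ⟨Classical.arbitrary α, fun h => absurd h hp, fun h => absurd h hq, fun h => absurd h hr⟩

/-- If every descendant of `B` in the range allows every machine to leave without transition
waste, then the range is a zero-waste range. -/
theorem isZeroWasteRange_of_descendant {M F L : ℕ} {B : TaskList M F} (hB : IsTAS L B)
    {Nmin : ℤ} (hL : (L : ℤ) ≤ Nmin) (hmin : Nmin ≤ M) (hMF : M ≤ F)
    (hleave : ∀ (N : ℕ) (S : TaskList (N + 1) F) (n : Fin (N + 1)), Nmin ≤ N → N + 1 ≤ M →
      Descendant L B (N + 1) S → ∃ S' : TaskList N F, Descendant L B N S' ∧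
        ∀ i : Fin N, S (n.succAbove i) ⊆ S' i) :
    IsZeroWasteRange L F Nmin M := by
  classical
  choose lv lv1 lv2 lv3 using fun (N : ℕ) (S : TaskList (N + 1) F) (n : Fin (N + 1)) =>
    exists_preferred (α := TaskList N F)
      (p := fun S' => Descendant L B N S' ∧ ∀ i : Fin N, S (n.succAbove i) ⊆ S' i)
      (q := fun S' => Descendant L B N S') (r := fun S' => IsTAS L S')
      (fun _ h => h.1) (fun _ h => h.isTAS hB)
  choose jn jn1 jn2 jn3 using fun (N : ℕ) (S : TaskList N F) =>
    exists_preferred (α := TaskList (N + 1) F)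
      (p := fun S' => Descendant L B (N + 1) S' ∧ ∀ i : Fin N, S' i.castSucc ⊆ S i)
      (q := fun S' => Descendant L B (N + 1) S') (r := fun S' => IsTAS L S')
      (fun _ h => h.1) (fun _ h => h.isTAS hB)
  let T : TransitionMap F := ⟨lv, jn⟩
  -- Letting machines leave `B` gives a descendant for every number of machines in the range.
  have hex : ∀ d N : ℕ, N + d = M → Nmin ≤ N → ∃ S : TaskList N F, Descendant L B N S := by
    intro d
    induction d with
    | zero => rintro N rfl _; exact ⟨B, .base⟩
    | succ d ih =>
      intro N hN hm
      obtain ⟨S, hS⟩ := ih (N + 1) (by omega) (by push_cast; omega)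
      obtain ⟨S', hS', -⟩ := hleave N S (Fin.last N) hm (by omega) hS
      exact ⟨S', hS'⟩
  have hex' : ∀ N : ℕ, Nmin ≤ N → (N : ℤ) ≤ M → ∃ S : TaskList N F, Descendant L B N S :=
    fun N h1 h2 => hex (M - N) N (by omega) h1
  refine ⟨hL, hmin, by exact_mod_cast hMF, fun N₀ h1 h2 => ?_⟩
  obtain ⟨S₀, hS₀⟩ := hex' N₀ h1 h2
  have hreach : ∀ (N : ℕ) (S : TaskList N F), Reachable L S₀ T N S →
      IsTAS L S ∧ (Nmin ≤ N → (N : ℤ) ≤ M → Descendant L B N S) := by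
    intro N S h
    induction h with
    | start => exact ⟨hS₀.isTAS hB, fun _ _ => hS₀⟩
    | leave n _ hE _ => exact ⟨lv3 _ _ n hE, fun a b => lv2 _ _ n (hex' _ a b)⟩
    | join _ hE _ => exact ⟨jn3 _ _ hE, fun a b => jn2 _ _ (hex' _ a b)⟩
  refine ⟨S₀, T, ⟨hS₀.isTAS hB, fun N S n _ hE => lv3 N S n hE, fun N S _ hE => jn3 N S hE⟩,
    fun N S n hR ha hb => ?_, fun N S hR ha hb => ?_⟩
  · obtain ⟨hS, hD⟩ := hreach _ _ hR
    have h := lv1 N S n (hleave N S n ha (by exact_mod_cast hb) (hD (by push_cast; omega) hb))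
    exact leaveWaste_eq_zero hS (h.1.isTAS hB) h.2
  · obtain ⟨hS, hD⟩ := hreach _ _ hR
    have h := jn1 N S ((hD ha (by push_cast at hb; omega)).exists_join (by omega))
    exact joinWaste_eq_zero hS (h.1.isTAS hB) h.2

/-! ### Configurations and their base allocations -/

/-- There is a configuration of `M` points and `M` lines, with `L` points on every line and `L`
lines through every point, in which two points have at most one line in common. -/
def ExistsConfiguration (L M : ℕ) : Prop :=
  ∃ inc : Fin M → Fin M → Prop, (∀ l, Nat.card {p // inc p l} = L) ∧
    (∀ p, Nat.card {l // inc p l} = L) ∧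
    ∀ p p', p ≠ p' → ∀ l l', inc p l → inc p' l → inc p l' → inc p' l' → l = l'

theorem ExistsConfiguration.of_types {L M : ℕ} {P Λ : Type*} (hP : Nat.card P = M)
    (hΛ : Nat.card Λ = M) (hM : 0 < M) (inc : P → Λ → Prop)
    (h1 : ∀ l, Nat.card {p // inc p l} = L) (h2 : ∀ p, Nat.card {l // inc p l} = L)
    (h3 : ∀ p p', p ≠ p' → ∀ l l', inc p l → inc p' l → inc p l' → inc p' l' → l = l') :
    ExistsConfiguration L M := by
  have : Finite P := Nat.finite_of_card_ne_zero (by omega)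
  have : Finite Λ := Nat.finite_of_card_ne_zero (by omega)
  let e := (Finite.equivFinOfCardEq hP).symm
  let e' := (Finite.equivFinOfCardEq hΛ).symm
  refine ⟨fun p l => inc (e p) (e' l), fun l => ?_, fun p => ?_, fun p p' hp l l' a b c d =>
    e'.injective (h3 _ _ (e.injective.ne hp) _ _ a b c d)⟩
  · rw [← h1 (e' l)]
    exact Nat.card_congr (e.subtypeEquiv fun _ => Iff.rfl)
  · rw [← h2 (e p)]
    exact Nat.card_congr (e'.subtypeEquiv fun _ => Iff.rfl)

/-- Machines are points, each line carries `k` tasks, and a machine holds the tasks of the lines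
through it. -/
theorem ExistsConfiguration.exists_isTAS {L M : ℕ} (h : ExistsConfiguration L M) (k : ℕ)
    (hM : 0 < M) :
    ∃ B : TaskList M (M * k), IsTAS L B ∧ ∀ i j, i ≠ j → (B i ∩ B j).card ≤ k := by
  classical
  obtain ⟨inc, h1, h2, h3⟩ := h
  let line : Fin (M * k) → Fin M := fun f => (finProdFinEquiv.symm f).1
  have hfib : ∀ s : Finset (Fin M),
      (Finset.univ.filter fun f => line f ∈ s).card = s.card * k := fun s => by
    rw [show s.card * k = (s ×ˢ (Finset.univ : Finset (Fin k))).card by simp]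
    exact Finset.card_bij (fun f _ => finProdFinEquiv.symm f)
      (fun f hf => by
        rw [Finset.mem_product]
        exact ⟨(Finset.mem_filter.1 hf).2, Finset.mem_univ _⟩)
      (fun a _ b _ hab => finProdFinEquiv.symm.injective hab)
      (fun p hp => ⟨finProdFinEquiv p, by
        rw [Finset.mem_product] at hp
        simpa only [Finset.mem_filter, Finset.mem_univ, true_and, line, Equiv.symm_apply_apply]
          using hp.1, by simp⟩)
  refine ⟨fun i => Finset.univ.filter fun f => line f ∈ Finset.univ.filter fun l => inc i l,
    ⟨fun f => ?_, ⟨L * k, by ring⟩, fun n => ?_⟩, fun i j hij => ?_⟩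
  · rw [← h1 (line f), Nat.card_eq_fintype_card, Fintype.card_subtype]
    simp
  · rw [hfib, ← Fintype.card_subtype, ← Nat.card_eq_fintype_card, h2,
      show L * (M * k) = M * (L * k) by ring, Nat.mul_div_cancel_left _ hM]
  · rw [← Finset.filter_and]
    simp_rw [← Finset.mem_inter]
    rw [hfib]
    refine (Nat.mul_le_mul_right k (Finset.card_le_one.2 ?_)).trans_eq (one_mul k)
    intro a ha b hb
    simp only [Finset.mem_inter, Finset.mem_filter, Finset.mem_univ, true_and] at ha hb
    exact h3 i j hij a b ha.1 ha.2 hb.1 hb.2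

/-- A configuration gives a zero-waste range whose lower end is determined by a quadratic
inequality. -/
theorem ExistsConfiguration.zeroWasteForRelevant {L M : ℕ} (h : ExistsConfiguration L M)
    (hL : 2 ≤ L) {Nmin : ℤ} (hpos : 1 ≤ Nmin) (hmax : Nmin + 1 ≤ M)
    (hq : ∀ n : ℤ, Nmin + 1 ≤ n → n ≤ M →
      n * (n - 1) + 2 * L * (M - n) * (n - 1) ≤ L * M * (n - L)) :
    ZeroWasteForRelevant L Nmin M := by
  intro F hF hdvd
  -- The left side of the quadratic inequality is positive, which forces `n > L`.
  have hLn : ∀ n : ℤ, Nmin + 1 ≤ n → n ≤ M → (L : ℤ) ≤ n - 1 := fun n h1 h2 => by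
    have h3 := hq n h1 h2
    have h4 : 0 < n * (n - 1) := mul_pos (by omega) (by omega)
    have h5 : 0 ≤ 2 * L * (M - n) * (n - 1) :=
      mul_nonneg (mul_nonneg (by positivity) (by omega)) (by omega)
    have h6 : 0 < (L * M : ℤ) * (n - L) := by linarith
    have h7 : 0 < n - L := pos_of_mul_pos_right h6 (by positivity)
    omega
  have hM2 : 2 ≤ M := by omega
  have hMd : (M : ℤ) * (M - 1) ∣ (F : ℤ) := hdvd M hmax le_rfl
  have hMk : M ∣ F := by exact_mod_cast (Dvd.intro _ rfl : (M : ℤ) ∣ M * (M - 1)).trans hMd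
  obtain ⟨k, rfl⟩ := hMk
  obtain ⟨B, hB, hk⟩ := h.exists_isTAS k (by omega)
  refine isZeroWasteRange_of_descendant hB (by have := hLn _ le_rfl hmax; omega) (by omega)
    (Nat.le_of_dvd hF (Dvd.intro _ rfl)) fun N S n hN hNM hS => ?_
  have h1 := hq (N + 1) (by omega) (by omega)
  have h2 := hLn (N + 1) (by omega) (by omega)
  have h3 := hdvd (N + 1) (by omega) (by omega)
  rw [add_sub_cancel_right] at h1 h2 h3
  exact hS.exists_leave hB rfl hk n (by omega) (by omega) (by exact_mod_cast h3) h1 (by omega)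

/-! ### Cyclic, affine and projective configurations -/

namespace ExistsConfiguration

/-- A set of natural numbers below `M / 2` whose differences are distinct gives a cyclic
configuration. -/
theorem of_sidon {M m : ℕ} (D : Finset ℕ) (hm : ∀ d ∈ D, d ≤ m) (hmM : 2 * m < M)
    (hD : ∀ a ∈ D, ∀ b ∈ D, ∀ c ∈ D, ∀ d ∈ D, a + d = b + c → a = b ∨ a = c) :
    ExistsConfiguration D.card M := by
  classical
  have : NeZero M := ⟨by omega⟩
  -- Sums of two elements of `D` stay below `M`, so the Sidon property survives reduction modulo
  -- `M`.
  have hcast : ∀ a b : ℕ, a ≤ 2 * m → b ≤ 2 * m → (a : ZMod M) = b → a = b := fun a b ha hb h =>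
    Nat.ModEq.eq_of_lt_of_lt ((ZMod.natCast_eq_natCast_iff _ _ _).1 h) (by omega) (by omega)
  set E : Finset (ZMod M) := D.image (Nat.cast : ℕ → ZMod M) with hE
  have hcard : Nat.card {x // x ∈ E} = D.card := by
    rw [Nat.card_eq_fintype_card, Fintype.card_coe, hE, Finset.card_image_of_injOn]
    intro a ha b hb h
    exact hcast a b (by have := hm a ha; omega) (by have := hm b hb; omega) h
  refine of_types (P := ZMod M) (Λ := ZMod M) (Nat.card_zmod M) (Nat.card_zmod M) (by omega)
    (fun p l => p - l ∈ E) (fun l => ?_) (fun p => ?_) ?_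
  · rw [← hcard]
    exact Nat.card_congr ((Equiv.subRight l).subtypeEquiv fun _ => Iff.rfl)
  · rw [← hcard]
    exact Nat.card_congr ((Equiv.subLeft p).subtypeEquiv fun _ => Iff.rfl)
  · intro p p' hp l l' h1 h2 h3 h4
    simp only [hE, Finset.mem_image] at h1 h2 h3 h4
    obtain ⟨a, ha, ha'⟩ := h1
    obtain ⟨b, hb, hb'⟩ := h2
    obtain ⟨c, hc, hc'⟩ := h3
    obtain ⟨d, hd, hd'⟩ := h4
    have h : ((a + d : ℕ) : ZMod M) = ((b + c : ℕ) : ZMod M) := by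
      push_cast
      rw [ha', hb', hc', hd']
      ring
    rcases hD a ha b hb c hc d hd (hcast _ _ (by have := hm a ha; have := hm d hd; omega)
      (by have := hm b hb; have := hm c hc; omega) h) with rfl | rfl
    · exact absurd (sub_left_injective (ha'.symm.trans hb')) hp
    · exact sub_right_injective (ha'.symm.trans hc')

theorem three {M : ℕ} (hM : 7 ≤ M) : ExistsConfiguration 3 M :=
  of_sidon (m := 3) {0, 1, 3} (by decide) (by omega) (by decide)

theorem four {M : ℕ} (hM : 13 ≤ M) : ExistsConfiguration 4 M :=
  of_sidon (m := 6) {0, 1, 4, 6} (by decide) (by omega) (by decide)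

variable (K : Type*) [Field K] [Finite K]

/-- The points of the affine plane and the lines that are not vertical. -/
theorem affine : ExistsConfiguration (Nat.card K) (Nat.card K ^ 2) := by
  have hc : Nat.card (K × K) = Nat.card K ^ 2 := by rw [Nat.card_prod, sq]
  refine of_types hc hc (pow_pos Nat.card_pos 2) (fun p l => p.2 = l.1 * p.1 + l.2) (fun l => ?_)
    (fun p => ?_) ?_
  · exact Nat.card_congr
      { toFun := fun p => p.1.1
        invFun := fun x => ⟨(x, l.1 * x + l.2), rfl⟩
        left_inv := fun p => Subtype.ext (Prod.ext rfl p.2.symm)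
        right_inv := fun _ => rfl }
  · exact Nat.card_congr
      { toFun := fun l => l.1.1
        invFun := fun m => ⟨(m, p.2 - m * p.1), by simp⟩
        left_inv := fun l => Subtype.ext (Prod.ext rfl (by simp [l.2]))
        right_inv := fun _ => rfl }
  · rintro ⟨x, y⟩ ⟨x', y'⟩ hp ⟨m, b⟩ ⟨m', b'⟩ h1 h2 h3 h4
    simp only at h1 h2 h3 h4
    have hx : x - x' ≠ 0 := fun h => hp (by
      obtain rfl : x = x' := sub_eq_zero.1 h
      rw [h1, h2])
    have hm : m = m' := by
      refine mul_right_cancel₀ hx ?_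
      linear_combination h2 - h1 + h3 - h4
    subst hm
    refine Prod.ext rfl ?_
    linear_combination h3 - h1

/-- The points of the affine plane other than the origin, and the lines not through the origin. -/
theorem punctured_affine : ExistsConfiguration (Nat.card K) (Nat.card K ^ 2 - 1) := by
  classical
  have hc : Nat.card {v : K × K // v ≠ 0} = Nat.card K ^ 2 - 1 := by
    have := Fintype.ofFinite K
    rw [Nat.card_eq_fintype_card, Fintype.card_subtype_compl, Fintype.card_subtype_eq,
      Fintype.card_prod, Nat.card_eq_fintype_card, sq]
  -- The line ax + by = 1 is encoded by (a, b); incidence is symmetric, so this count also gives the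
  -- lines through a point.
  have hline : ∀ l : {v : K × K // v ≠ 0},
      Nat.card {p : {v : K × K // v ≠ 0} // l.1.1 * p.1.1 + l.1.2 * p.1.2 = 1} = Nat.card K := by
    rintro ⟨⟨a, b⟩, hab⟩
    have hne : ∀ v : K × K, a * v.1 + b * v.2 = 1 → v ≠ 0 := by
      rintro v hv rfl
      simp at hv
    by_cases hb : b = 0
    · have ha : a ≠ 0 := fun ha => hab (by rw [ha, hb]; rfl)
      have h : ∀ y, a * (a⁻¹ : K) + b * y = 1 := fun y => by rw [hb]; field_simp; ring
      exact Nat.card_congr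
        { toFun := fun p => p.1.1.2
          invFun := fun y => ⟨⟨(a⁻¹, y), hne _ (h y)⟩, h y⟩
          left_inv := fun p => Subtype.ext (Subtype.ext (Prod.ext (by
            have := p.2
            simp only [hb, zero_mul, add_zero] at this
            exact (eq_inv_of_mul_eq_one_right this).symm) rfl))
          right_inv := fun _ => rfl }
    · have h : ∀ x, a * x + b * (b⁻¹ * (1 - a * x)) = 1 := fun x => by field_simp; ring
      exact Nat.card_congr
        { toFun := fun p => p.1.1.1
          invFun := fun x => ⟨⟨(x, b⁻¹ * (1 - a * x)), hne _ (h x)⟩, h x⟩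
          left_inv := fun p => Subtype.ext (Subtype.ext (Prod.ext rfl (by
            have hp := p.2
            simp only at hp ⊢
            rw [inv_mul_eq_iff_eq_mul₀ hb]
            linear_combination -hp)))
          right_inv := fun _ => rfl }
  refine of_types hc hc (Nat.sub_pos_of_lt (Nat.one_lt_pow two_ne_zero Finite.one_lt_card))
    (fun p l => l.1.1 * p.1.1 + l.1.2 * p.1.2 = 1) hline (fun p => ?_) ?_
  · rw [← hline p]
    exact Nat.card_congr (Equiv.subtypeEquivRight fun l => by
      rw [mul_comm l.1.1, mul_comm l.1.2])
  · rintro ⟨⟨x, y⟩, _⟩ ⟨⟨x', y'⟩, _⟩ hp ⟨⟨a, b⟩, _⟩ ⟨⟨a', b'⟩, _⟩ h1 h2 h3 h4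
    simp only at h1 h2 h3 h4
    -- Proportional points on a common line coincide; otherwise Cramer's rule determines the line.
    by_cases hD : x * y' - x' * y = 0
    · refine absurd (Subtype.ext (Prod.ext ?_ ?_)) hp
      · linear_combination x' * h1 - x * h2 + b * hD
      · linear_combination y' * h1 - y * h2 - a * hD
    · refine Subtype.ext (Prod.ext (mul_right_cancel₀ hD ?_) (mul_right_cancel₀ hD ?_))
      · linear_combination y' * (h1 - h3) - y * (h2 - h4)
      · linear_combination x * (h2 - h4) - x' * (h1 - h3)

open Configuration Configuration.ofField in
open scoped LinearAlgebra.Projectivization in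
theorem projective :
    ExistsConfiguration (Nat.card K + 1) (Nat.card K ^ 2 + Nat.card K + 1) := by
  classical
  have hc : Nat.card (ℙ K (Fin 3 → K)) = Nat.card K ^ 2 + Nat.card K + 1 := by
    rw [Projectivization.card_of_finrank K _ (Module.finrank_fin_fun K)]
    simp only [Finset.sum_range_succ, Finset.sum_range_zero]
    ring
  have : Finite (ℙ K (Fin 3 → K)) := Nat.finite_of_card_ne_zero (by omega)
  have := Fintype.ofFinite (ℙ K (Fin 3 → K))
  -- The order is recovered from the number of points.
  have ho : ProjectivePlane.order (ℙ K (Fin 3 → K)) (ℙ K (Fin 3 → K)) = Nat.card K := by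
    have h := ProjectivePlane.card_points (ℙ K (Fin 3 → K)) (ℙ K (Fin 3 → K))
    rw [← Nat.card_eq_fintype_card, hc] at h
    nlinarith
  refine of_types hc hc (by omega) (fun p l => p ∈ l) (fun l => ?_) (fun p => ?_) ?_
  · rw [← ho]
    exact ProjectivePlane.pointCount_eq _ l
  · rw [← ho]
    exact ProjectivePlane.lineCount_eq _ p
  · exact fun p p' hp l l' h1 h2 h3 h4 =>
      (Nondegenerate.eq_or_eq h1 h2 h3 h4).resolve_left hp

end ExistsConfiguration

/-! ### Explicit bounds -/

theorem IsPrimePow.exists_finite_field {q : ℕ} (hq : IsPrimePow q) :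
    ∃ (K : Type) (_ : Field K) (_ : Finite K), Nat.card K = q := by
  obtain ⟨p, n, hp, hn, rfl⟩ := hq
  have : Fact p.Prime := ⟨hp.nat_prime⟩
  exact ⟨GaloisField p n, inferInstance, inferInstance, GaloisField.card p n hn.ne'⟩

/-- The lower end of the range, as the root of the quadratic inequality. -/
theorem ExistsConfiguration.zeroWasteForRelevant_floor {L M : ℕ} (h : ExistsConfiguration L M)
    (hL : 2 ≤ L) (hLM : L + 1 ≤ M) {u v w : ℝ} (hu : u = (3 * L - 2) * M - (2 * L - 1))
    (hv : v = (L * M + 2 * L - 1) ^ 2 + 4 * (2 * L - 1) * L * (L - 2) * M)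
    (hw : w = 2 * (2 * L - 1)) :
    ZeroWasteForRelevant L (M - ⌊(u - √v) / w⌋ - 1) M := by
  have hLr : (2 : ℝ) ≤ L := by exact_mod_cast hL
  have hMr : (L : ℝ) + 1 ≤ M := by exact_mod_cast hLM
  have hw0 : 0 < w := by linarith
  have hLM0 : (0 : ℝ) ≤ L * M := by positivity
  have hb0 : (0 : ℝ) ≤ L * M + 2 * L - 1 := by linarith
  have hc0 : (0 : ℝ) ≤ L * (L - 2) * M :=
    mul_nonneg (mul_nonneg (by positivity) (by linarith)) (by positivity)
  have hv1 : ((L : ℝ) * M + 2 * L - 1) ^ 2 ≤ v := by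
    have : (0 : ℝ) ≤ 4 * (2 * L - 1) * (L * (L - 2) * M) := mul_nonneg (by linarith) hc0
    linarith
  have hv0 : 0 ≤ v := (sq_nonneg _).trans hv1
  have hs0 := Real.sqrt_nonneg v
  have hsq := Real.sq_sqrt hv0
  have hs1 : (L : ℝ) * M + 2 * L - 1 ≤ √v := Real.le_sqrt_of_sq_le hv1
  -- The inequality reads (2L-1)n² - (LM+2L-1)n - L(L-2)M ≥ 0. Its discriminant is `v`, and `(u -
  -- √v) / w` is M minus its larger root.
  have hn : ∀ n : ℤ, M - ⌊(u - √v) / w⌋ ≤ n → √v ≤ w * n - (L * M + 2 * L - 1) := fun n hn => by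
    have h1 : ((M : ℝ) - ⌊(u - √v) / w⌋) ≤ n := by exact_mod_cast hn
    have h2 := Int.floor_le ((u - √v) / w)
    rw [le_div_iff₀ hw0] at h2
    generalize ⌊(u - √v) / w⌋ = A at h1 h2
    have h3 := mul_le_mul_of_nonneg_left h1 hw0.le
    rw [hu] at h2
    rw [hw] at h2 h3 ⊢
    linarith
  have hfloor : 0 ≤ ⌊(u - √v) / w⌋ := by
    refine Int.floor_nonneg.2 (div_nonneg (sub_nonneg.2 (Real.sqrt_le_iff.2 ⟨?_, ?_⟩)) hw0.le)
    · rw [hu]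
      nlinarith
    -- This product is `u ^ 2 - v`.
    · have h1 : (0 : ℝ) ≤ (4 * (2 * L - 1) * M) * ((L - 1) * (M - L - 1)) :=
        mul_nonneg (mul_nonneg (by linarith) (by positivity))
          (mul_nonneg (by linarith) (by linarith))
      rw [hv, hu]
      linarith
  refine h.zeroWasteForRelevant hL ?_ (by omega) fun n h1 _ => ?_
  · have h1 := hn (M - ⌊(u - √v) / w⌋) le_rfl
    have h2 : (1 : ℝ) < ((M - ⌊(u - √v) / w⌋ : ℤ) : ℝ) := by
      refine lt_of_mul_lt_mul_left ?_ hw0.le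
      have : (0 : ℝ) < L * M := mul_pos (by linarith) (by linarith)
      linarith
    have h3 : 1 < (M - ⌊(u - √v) / w⌋ : ℤ) := by exact_mod_cast h2
    omega
  · have h2 := hn n (by omega)
    have h3 := pow_le_pow_left₀ hs0 h2 2
    rw [hsq, hv, hw] at h3
    have h4 : 0 ≤ (4 * (2 * L - 1) : ℝ) *
        ((2 * L - 1) * n ^ 2 - (L * M + 2 * L - 1) * n - L * (L - 2) * M) := by linarith
    have h5 := nonneg_of_mul_nonneg_right h4 (by linarith)
    have h6 : (n : ℝ) * (n - 1) + 2 * L * (M - n) * (n - 1) ≤ L * M * (n - L) := by linarith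
    exact_mod_cast h6
theorem mainTheorem9 :
    (∀ M : ℕ, 7 ≤ M →
      ZeroWasteForRelevant 3
        ((M : ℤ) - ⌊(7 * (M : ℝ) - 5 - Real.sqrt (9 * (M : ℝ) ^ 2 + 90 * M + 25)) / 10⌋ - 1)
        (M : ℤ)) ∧
    (∀ M : ℕ, 13 ≤ M →
      ZeroWasteForRelevant 4
        ((M : ℤ) - ⌊(10 * (M : ℝ) - 7 - Real.sqrt (16 * (M : ℝ) ^ 2 + 280 * M + 49)) / 14⌋ - 1)
        (M : ℤ)) ∧
    (∀ q : ℕ, IsPrimePow q →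
      ZeroWasteForRelevant (q + 1)
        (((q : ℤ) ^ 2 + q + 1) -
          ⌊(3 * (q : ℝ) ^ 3 + 4 * (q : ℝ) ^ 2 + 2 * q -
              Real.sqrt ((q : ℝ) ^ 6 + 12 * (q : ℝ) ^ 5 + 24 * (q : ℝ) ^ 4 + 24 * (q : ℝ) ^ 3 +
                16 * (q : ℝ) ^ 2 + 4 * q)) / (4 * q + 2)⌋ - 1)
        ((q : ℤ) ^ 2 + q + 1)) ∧
    (∀ q : ℕ, IsPrimePow q →
      ZeroWasteForRelevant q
        ((q : ℤ) ^ 2 -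
          ⌊(3 * (q : ℝ) ^ 3 - 2 * (q : ℝ) ^ 2 - 2 * q + 1 -
              Real.sqrt ((q : ℝ) ^ 6 + 8 * (q : ℝ) ^ 5 - 16 * (q : ℝ) ^ 4 + 6 * (q : ℝ) ^ 3 +
                4 * (q : ℝ) ^ 2 - 4 * q + 1)) / (4 * q - 2)⌋ - 1)
        ((q : ℤ) ^ 2)) ∧
    (∀ q : ℕ, IsPrimePow q →
      ZeroWasteForRelevant q
        (((q : ℤ) ^ 2 - 1) -
          ⌊(3 * (q : ℝ) ^ 3 - 2 * (q : ℝ) ^ 2 - 5 * q + 3 -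
              Real.sqrt ((q : ℝ) ^ 6 + 8 * (q : ℝ) ^ 5 - 18 * (q : ℝ) ^ 4 - 2 * (q : ℝ) ^ 3 +
                21 * (q : ℝ) ^ 2 - 10 * q + 1)) / (4 * q - 2)⌋ - 1)
        ((q : ℤ) ^ 2 - 1)) := by
  refine ⟨fun M hM => ?_, fun M hM => ?_, fun q hq => ?_, fun q hq => ?_, fun q hq => ?_⟩
  · exact (ExistsConfiguration.three hM).zeroWasteForRelevant_floor (by norm_num) (by omega)
      (by push_cast; ring) (by push_cast; ring) (by norm_num)
  · exact (ExistsConfiguration.four hM).zeroWasteForRelevant_floor (by norm_num) (by omega)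
      (by push_cast; ring) (by push_cast; ring) (by norm_num)
  · obtain ⟨K, _, _, rfl⟩ := hq.exists_finite_field
    have h2 := hq.two_le
    have h := (ExistsConfiguration.projective K).zeroWasteForRelevant_floor (by omega) (by nlinarith)
      rfl rfl rfl
    push_cast at h
    convert h using 6
    · ring
    · congr 1
      ring
    · ring
  · obtain ⟨K, _, _, rfl⟩ := hq.exists_finite_field
    have h2 := hq.two_le
    have h := (ExistsConfiguration.affine K).zeroWasteForRelevant_floor h2 (by nlinarith)
      rfl rfl rfl
    push_cast at h
    convert h using 6
    · ring
    · congr 1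
      ring
    · ring
  · obtain ⟨K, _, _, rfl⟩ := hq.exists_finite_field
    have h2 := hq.two_le
    have h1 : 1 ≤ Nat.card K ^ 2 := Nat.one_le_pow _ _ (by omega)
    have h3 : Nat.card K + 2 ≤ Nat.card K ^ 2 := by nlinarith
    have h := (ExistsConfiguration.punctured_affine K).zeroWasteForRelevant_floor h2 (by omega)
      rfl rfl rfl
    push_cast [Nat.cast_sub h1] at h
    convert h using 6
    · ring
    · congr 1
      ring
    · ring
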